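/- Let $\mathcal H$ be a real Hilbert space and let $f:\mathcal H\to\mathbb R\cup\{+\infty\}$ be a convex, lower semicontinuous and proper function with $\operatorname{argmin}_{\mathcal H} f\neq\emptyset$. Fix $\lambda>0$. For $x\in\mathcal H$ let $$f_\lambda(x)=\min_{\xi\in\mathcal H}\Big\{f(\xi)+\frac1{2\lambda}\|x-\xi\|^2\Big\}$$ be the Moreau envelope of $f$, and let $\operatorname{prox}_{\lambda f}x$ be the unique point $\xi$ at which this minimum is attained. Let $t_0>0$, $\alpha\in\mathbb R$, and let $u:[t_0,+\infty[\to\mathcal H$ be a classical (i.e. $\mathcal C^3$) solution of $$\text{(TOGES-VR)}\qquad \dddot u(t)+\frac{\alpha+7}{t}\,\ddot u(t)+\frac{5(\alpha+1)}{t^2}\,\dot u(t)+\nabla f_\lambda\Big(u(t)+\frac14t\,\dot u(t)\Big)=0,\qquad t\in[t_0,+\infty[.$$ a) Suppose that $\alpha\ge 3$. Then, as $t\to+\infty$: (i) $f_\lambda\big(u(t)+\frac14t\dot u(t)\big)-\inf_{\mathcal H}f=\mathcal O(1/t^3)$ and $f\big(\operatorname{prox}_{\lambda f}(u(t)+\frac14t\dot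 u(t))\big)-\inf_{\mathcal H}f=\mathcal O(1/t^3)$; (ii) $f_\lambda(u(t))-\inf_{\mathcal H}f=\mathcal O(1/t^3)$ and $f\big(\operatorname{prox}_{\lambda f}u(t)\big)-\inf_{\mathcal H}f=\mathcal O(1/t^3)$. b) Suppose that $\alpha>3$. Then, as $t\to+\infty$: (iii) $f_\lambda\big(u(t)+\frac14t\dot u(t)\big)-\inf_{\mathcal H}f=o(1/t^3)$ and $f\big(\operatorname{prox}_{\lambda f}(u(t)+\frac14t\dot u(t))\big)-\inf_{\mathcal H}f=o(1/t^3)$; (iv) $f_\lambda(u(t))-\inf_{\mathcal H}f=o(1/t^3)$ and $f\big(\operatorname{prox}_{\lambda f}u(t)\big)-\inf_{\mathcal H}f=o(1/t^3)$; (v) $u(t)$ converges weakly as $t\to+\infty$ to some $u_\infty\in\operatorname{argmin}_{\mathcal H}f$. -/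

import Mathlib

open Filter Topology Set Asymptotics

/-- `f : H → ℝ ∪ {+∞}` (encoded as an `EReal`-valued function that never takes the value `-∞`)
is proper: it is not identically `+∞`. -/
def IsProperFun {H : Type*} (f : H → EReal) : Prop :=
  (∀ x, f x ≠ ⊥) ∧ ∃ x, f x ≠ ⊤

/-- Convexity (Jensen's inequality) of a function with values in `ℝ ∪ {+∞}`. -/
def IsConvexFun {H : Type*} [AddCommGroup H] [Module ℝ H] (f : H → EReal) : Prop :=
  ∀ x y : H, ∀ a b : ℝ, 0 < a → 0 < b → a + b = 1 →
    f (a • x + b • y) ≤ (a : EReal) * f x + (b : EReal) * f y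

section Moreau

variable {H : Type*} [NormedAddCommGroup H]

/-- The function `ξ ↦ f ξ + (1 / (2 lam)) ‖x - ξ‖ ^ 2`. -/
noncomputable def moreauObjective (f : H → EReal) (lam : ℝ) (x ξ : H) : EReal :=
  f ξ + ((1 / (2 * lam) * ‖x - ξ‖ ^ 2 : ℝ) : EReal)

/-- The Moreau envelope `f_lam x = inf_ξ (f ξ + (1 / (2 lam)) ‖x - ξ‖ ^ 2)`, as a real-valued
function. (The infimum is a real number and it is attained: see `coe_moreauEnvelope`,
`isMinOn_prox` below.) -/
noncomputable def moreauEnvelope (f : H → EReal) (lam : ℝ) (x : H) : ℝ :=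
  (⨅ ξ, moreauObjective f lam x ξ).toReal

/-- The proximal mapping: `prox f lam x` is the minimizer of
`ξ ↦ f ξ + (1 / (2 lam)) ‖x - ξ‖ ^ 2`. (It exists and is unique: see `existsUnique_prox`.) -/
noncomputable def prox (f : H → EReal) (lam : ℝ) (x : H) : H :=
  Classical.epsilon fun p => IsMinOn (moreauObjective f lam x) univ p

end Moreau

/-- `u : [t₀, +∞[ → H` is a classical (three times continuously differentiable) solution of the
third-order evolution equation
`u''' + ((α + 7) / t) u'' + (5 (α + 1) / t ^ 2) u' + ∇ g (u + (t / 4) u') = 0` on `[t₀, +∞[`.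
Derivatives are taken within `[t₀, +∞[`, so they are one-sided at `t₀` and the values of `u`
outside `[t₀, +∞[` play no role. -/
structure IsTogesVSolution {H : Type*} [NormedAddCommGroup H] [InnerProductSpace ℝ H]
    [CompleteSpace H] (g : H → ℝ) (α t₀ : ℝ) (u : ℝ → H) : Prop where
  contDiffOn : ContDiffOn ℝ 3 u (Ici t₀)
  equation : ∀ t ∈ Ici t₀,
    iteratedDerivWithin 3 u (Ici t₀) t
      + ((α + 7) / t) • iteratedDerivWithin 2 u (Ici t₀) t
      + (5 * (α + 1) / t ^ 2) • derivWithin u (Ici t₀) t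
      + gradient g (u t + (t / 4) • derivWithin u (Ici t₀) t) = 0

/-! Well-posedness of the Moreau envelope and of the proximal mapping. -/

section WellPosed

variable {H : Type*} [NormedAddCommGroup H]

theorem le_moreauObjective {f : H → EReal} {lam : ℝ} (hlam : 0 < lam) (x ξ : H) :
    f ξ ≤ moreauObjective f lam x ξ := by
  unfold moreauObjective
  calc f ξ = f ξ + 0 := (add_zero _).symm
    _ ≤ _ := by
      gcongr
      exact_mod_cast (by positivity)

/-- The Moreau envelope is the infimum, which is a real number. -/
theorem coe_moreauEnvelope {f : H → EReal} (hf : IsProperFun f)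
    (hmin : ∃ z, IsMinOn f univ z) {lam : ℝ} (hlam : 0 < lam) (x : H) :
    ((moreauEnvelope f lam x : ℝ) : EReal) = ⨅ ξ, moreauObjective f lam x ξ := by
  obtain ⟨z, hz⟩ := hmin
  obtain ⟨y, hy⟩ := hf.2
  apply EReal.coe_toReal
  · refine ne_top_of_le_ne_top ?_ (iInf_le _ y)
    unfold moreauObjective
    exact EReal.add_ne_top hy (EReal.coe_ne_top _)
  · refine ne_bot_of_le_ne_bot (hf.1 z) (le_iInf fun ξ => ?_)
    exact (hz (mem_univ ξ)).trans (le_moreauObjective hlam x ξ)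

/-- The infimum of `f` is a real number. -/
theorem coe_toReal_iInf {X : Type*} {f : X → EReal} (hf : IsProperFun f) (hmin : ∃ z, IsMinOn f univ z) :
    (((⨅ x, f x).toReal : ℝ) : EReal) = ⨅ x, f x := by
  obtain ⟨z, hz⟩ := hmin
  obtain ⟨y, hy⟩ := hf.2
  exact EReal.coe_toReal (ne_top_of_le_ne_top hy (iInf_le _ y))
    (ne_bot_of_le_ne_bot (hf.1 z) (le_iInf fun ξ => hz (mem_univ ξ)))

theorem lowerSemicontinuous_moreauObjective {f : H → EReal} (hbot : ∀ ξ, f ξ ≠ ⊥)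
    (hf : LowerSemicontinuous f) (lam : ℝ) (x : H) :
    LowerSemicontinuous (moreauObjective f lam x) := by
  unfold moreauObjective
  refine LowerSemicontinuous.add' hf ?_ fun ξ => ?_
  · apply Continuous.lowerSemicontinuous
    exact continuous_coe_real_ereal.comp (by fun_prop)
  · exact EReal.continuousAt_add (Or.inr (EReal.coe_ne_bot _)) (Or.inl (hbot ξ))

variable [InnerProductSpace ℝ H]

theorem moreauObjective_midpoint {f : H → EReal} (hc : IsConvexFun f) {lam : ℝ} (hlam : 0 < lam)
    (x a b : H) {m r : ℝ} (hbot : ∀ ξ, f ξ ≠ ⊥)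
    (hm : ∀ ξ, (m : EReal) ≤ moreauObjective f lam x ξ)
    (ha : moreauObjective f lam x a ≤ (r : EReal)) (hb : moreauObjective f lam x b ≤ (r : EReal)) :
    ‖a - b‖ ^ 2 ≤ 8 * lam * (r - m) := by
  have htop : ∀ ξ, moreauObjective f lam x ξ ≤ (r : EReal) → f ξ ≠ ⊤ := fun ξ h h' => by
    have := (le_moreauObjective (f := f) hlam x ξ).trans h
    rw [h'] at this
    exact absurd (top_le_iff.1 this) (EReal.coe_ne_top _)
  have ea := EReal.coe_toReal (htop a ha) (hbot a)
  have eb := EReal.coe_toReal (htop b hb) (hbot b)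
  set ra := (f a).toReal
  set rb := (f b).toReal
  have hconv := hc a b (1 / 2) (1 / 2) (by norm_num) (by norm_num) (by norm_num)
  have hmid := hm ((1 / 2 : ℝ) • a + (1 / 2 : ℝ) • b)
  unfold moreauObjective at ha hb hmid
  rw [← ea] at ha
  rw [← eb] at hb
  rw [← ea, ← eb] at hconv
  have hmid2 := hmid.trans (add_le_add_left hconv _)
  norm_cast at ha hb hmid2
  have hpar := parallelogram_law_with_norm ℝ (x - a) (x - b)
  have e1 : x - ((1 / 2 : ℝ) • a + (1 / 2 : ℝ) • b) = (1 / 2 : ℝ) • ((x - a) + (x - b)) := by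
    module
  have e2 : x - a - (x - b) = b - a := by abel
  rw [e1, norm_smul] at hmid2
  rw [e2, norm_sub_rev b a] at hpar
  rw [mul_pow, Real.norm_eq_abs, abs_of_pos (by norm_num : (0 : ℝ) < 1 / 2)] at hmid2
  have hl : (1 / (2 * lam)) * lam = 1 / 2 := by field_simp
  have hS : ‖x - a + (x - b)‖ ^ 2 = 2 * ‖x - a‖ ^ 2 + 2 * ‖x - b‖ ^ 2 - ‖a - b‖ ^ 2 := by
    linarith
  rw [hS] at hmid2
  have key : (1 / (2 * lam)) * ‖a - b‖ ^ 2 ≤ 4 * (r - m) := by nlinarith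
  have := mul_le_mul_of_nonneg_left key hlam.le
  nlinarith

variable [CompleteSpace H]

/-- The proximal point exists and is unique. -/
theorem existsUnique_prox {f : H → EReal} (hf : IsProperFun f) (hc : IsConvexFun f)
    (hlsc : LowerSemicontinuous f) (hmin : ∃ z, IsMinOn f univ z) {lam : ℝ} (hlam : 0 < lam)
    (x : H) : ∃! p, IsMinOn (moreauObjective f lam x) univ p := by
  have hm := coe_moreauEnvelope hf hmin hlam x
  set m := moreauEnvelope f lam x
  have hle : ∀ ξ, (m : EReal) ≤ moreauObjective f lam x ξ := fun ξ => hm ▸ iInf_le _ ξ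
  have hex : ∀ n : ℕ, ∃ ξ, moreauObjective f lam x ξ ≤ ((m + 1 / ((n : ℝ) + 1) : ℝ) : EReal) := by
    intro n
    have : (⨅ ξ, moreauObjective f lam x ξ) < ((m + 1 / ((n : ℝ) + 1) : ℝ) : EReal) := by
      rw [← hm]
      exact_mod_cast lt_add_of_pos_right m (by positivity)
    obtain ⟨ξ, hξ⟩ := iInf_lt_iff.1 this
    exact ⟨ξ, hξ.le⟩
  choose s hs using hex
  have hlim : Tendsto (fun n : ℕ => 1 / ((n : ℝ) + 1)) atTop (𝓝 0) :=
    tendsto_one_div_add_atTop_nhds_zero_nat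
  have hmono : ∀ {k n : ℕ}, k ≤ n →
      moreauObjective f lam x (s n) ≤ ((m + 1 / ((k : ℝ) + 1) : ℝ) : EReal) := by
    intro k n hkn
    refine (hs n).trans ?_
    have := Nat.one_div_le_one_div (α := ℝ) hkn
    exact_mod_cast add_le_add_right this m
  have hcau : CauchySeq s := by
    refine cauchySeq_of_le_tendsto_0 (fun n : ℕ => √(8 * lam * (1 / ((n : ℝ) + 1)))) ?_ ?_
    · intro i j k hi hj
      rw [dist_eq_norm]
      apply Real.le_sqrt_of_sq_le
      have := moreauObjective_midpoint hc hlam x (s i) (s j) hf.1 hle (hmono hi) (hmono hj)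
      simpa using this
    · have h2 := (hlim.const_mul (8 * lam)).sqrt
      simpa using h2
  obtain ⟨p, hp⟩ := cauchySeq_tendsto_of_complete hcau
  have hpm : moreauObjective f lam x p ≤ (m : EReal) := by
    have hclosed := (lowerSemicontinuous_moreauObjective hf.1 hlsc lam x).isClosed_preimage
    have h1 : ∀ k : ℕ, moreauObjective f lam x p ≤ ((m + 1 / ((k : ℝ) + 1) : ℝ) : EReal) := by
      intro k
      refine (hclosed _).mem_of_tendsto hp ?_
      filter_upwards [eventually_ge_atTop k] with n hn using hmono hn
    have h2 : Tendsto (fun k : ℕ => ((m + 1 / ((k : ℝ) + 1) : ℝ) : EReal)) atTop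
        (𝓝 (m : EReal)) := by
      refine (continuous_coe_real_ereal.tendsto m).comp ?_
      simpa using hlim.const_add m
    exact ge_of_tendsto' h2 h1
  refine ⟨p, fun ξ _ => hpm.trans (hle ξ), fun q hq => ?_⟩
  have hqm : moreauObjective f lam x q ≤ (m : EReal) := (hq (mem_univ p)).trans hpm
  have := moreauObjective_midpoint hc hlam x q p hf.1 hle hqm hpm
  rw [sub_self, mul_zero] at this
  have h0 : ‖q - p‖ = 0 := by nlinarith [norm_nonneg (q - p)]
  exact sub_eq_zero.1 (norm_eq_zero.1 h0)

theorem isMinOn_prox {f : H → EReal} (hf : IsProperFun f) (hc : IsConvexFun f)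
    (hlsc : LowerSemicontinuous f) (hmin : ∃ z, IsMinOn f univ z) {lam : ℝ} (hlam : 0 < lam)
    (x : H) : IsMinOn (moreauObjective f lam x) univ (prox f lam x) :=
  Classical.epsilon_spec (existsUnique_prox hf hc hlsc hmin hlam x).exists

/-- The value of `f` at a proximal point is a real number. -/
theorem coe_toReal_prox {f : H → EReal} (hf : IsProperFun f) (hc : IsConvexFun f)
    (hlsc : LowerSemicontinuous f) (hmin : ∃ z, IsMinOn f univ z) {lam : ℝ} (hlam : 0 < lam)
    (x : H) : (((f (prox f lam x)).toReal : ℝ) : EReal) = f (prox f lam x) := by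
  refine EReal.coe_toReal ?_ (hf.1 _)
  obtain ⟨y, hy⟩ := hf.2
  have h := isMinOn_prox hf hc hlsc hmin hlam x (mem_univ y)
  refine ne_top_of_le_ne_top ?_ ((le_moreauObjective hlam x _).trans h)
  exact EReal.add_ne_top hy (EReal.coe_ne_top _)

end WellPosed

/-!
The third-order equation is a second-order one in disguise: the extrapolated trajectory
`v = u + (t / 4) u'` satisfies `v'' + ((α + 1) / t) v' + (t / 4) ∇G (v) = 0`, where `G` is the
Moreau envelope. For an inertial system `v'' + (a / t) v' + β ∇G (v) = 0` and a minimizer `z` of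
`G`, the function
`t² β (G (v) - G z) + (t² / 2) ‖v'‖² + ρ (t ⟪v - z, v'⟫ + ((a - 1) / 2) ‖v - z‖²)`
is nonincreasing for a whole interval of parameters `ρ`. A single `ρ` gives the `O` rate. Since the
function is affine in `ρ`, two values of `ρ` make its two parts converge separately; the first part
tends to zero because otherwise the Lyapunov function would decrease like `-log t`, and the second
part yields the convergence of `‖v - z‖`, hence weak convergence by Opial's lemma. Finally `u`
inherits everything from `v`, because `t⁴ u` has derivative `4 t³ v`.
-/

section Convex

open scoped RealInnerProductSpace

variable {H : Type*} [NormedAddCommGroup H] [InnerProductSpace ℝ H] [CompleteSpace H]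
  {g : H → ℝ} {d x y : H}

theorem hasDerivAt_comp_of_hasGradientAt {v : ℝ → H} {v' : H} {t : ℝ}
    (hd : HasGradientAt g d (v t)) (hv : HasDerivAt v v' t) :
    HasDerivAt (fun s => g (v s)) ⟪d, v'⟫ t := by
  simpa [Function.comp_def] using hd.hasFDerivAt.comp_hasDerivAt t hv

theorem add_inner_le_of_convexOn_of_hasGradientAt {s : Set H} (hg : ConvexOn ℝ s g)
    (hd : HasGradientAt g d x) (hx : x ∈ s) (hy : y ∈ s) : g x + ⟪d, y - x⟫ ≤ g y := by
  have hline : HasDerivAt (fun r : ℝ => g (AffineMap.lineMap x y r)) ⟪d, y - x⟫ 0 := by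
    have hd' : HasGradientAt g d (AffineMap.lineMap x y (0 : ℝ)) := by simpa using hd
    exact hasDerivAt_comp_of_hasGradientAt hd' AffineMap.hasDerivAt_lineMap
  have hslope := (hg.comp_affineMap (AffineMap.lineMap x y)).le_slope_of_hasDerivAt
    (by simpa using hx) (by simpa using hy) one_pos hline
  simp only [slope_def_field, Function.comp_apply, AffineMap.lineMap_apply_one,
    AffineMap.lineMap_apply_zero, sub_zero, div_one] at hslope
  linarith

theorem hasGradientAt_of_convexOn_of_le_quadratic {C : ℝ} (hg : ConvexOn ℝ univ g)
    (hle : ∀ h, g (x + h) ≤ g x + ⟪d, h⟫ + C * ‖h‖ ^ 2) : HasGradientAt g d x := by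
  rw [hasGradientAt_iff_isLittleO_nhds_zero]
  refine IsBigO.trans_isLittleO (g := fun h : H => ‖h‖ ^ 2) ?_
    (by simpa using isLittleO_norm_pow_id (E' := H) one_lt_two)
  refine IsBigO.of_bound C (Eventually.of_forall fun h => ?_)
  have hmid : g x ≤ 1 / 2 * g (x + h) + 1 / 2 * g (x + -h) := by
    have hcomb : (1 / 2 : ℝ) • (x + h) + (1 / 2 : ℝ) • (x + -h) = x := by module
    simpa only [hcomb, smul_eq_mul] using hg.2 (mem_univ (x + h)) (mem_univ (x + -h))
      (by norm_num : (0 : ℝ) ≤ 1 / 2) (by norm_num : (0 : ℝ) ≤ 1 / 2) (by norm_num)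
  have hpos := hle h
  have hneg := hle (-h)
  rw [inner_neg_right, norm_neg] at hneg
  rw [Real.norm_eq_abs, norm_pow, norm_norm, abs_le]
  constructor <;> linarith

end Convex

section MoreauEnvelope

open scoped RealInnerProductSpace

variable {H : Type*} [NormedAddCommGroup H] {f : H → EReal} {lam : ℝ} {x p z : H}

theorem moreauEnvelope_le (hf : IsProperFun f) (hmin : ∃ z, IsMinOn f univ z) (hlam : 0 < lam)
    (x : H) {ξ : H} {r : ℝ} (hr : f ξ ≤ (r : EReal)) :
    moreauEnvelope f lam x ≤ r + 1 / (2 * lam) * ‖x - ξ‖ ^ 2 := by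
  have hle : (moreauEnvelope f lam x : EReal) ≤ r + (1 / (2 * lam) * ‖x - ξ‖ ^ 2 : ℝ) :=
    calc (moreauEnvelope f lam x : EReal) = ⨅ η, moreauObjective f lam x η :=
          coe_moreauEnvelope hf hmin hlam x
      _ ≤ moreauObjective f lam x ξ := iInf_le _ ξ
      _ ≤ r + (1 / (2 * lam) * ‖x - ξ‖ ^ 2 : ℝ) := add_le_add_left hr _
  exact_mod_cast hle

theorem coe_toReal_of_isMinOn_moreauObjective (hf : IsProperFun f)
    (hp : IsMinOn (moreauObjective f lam x) univ p) : ((f p).toReal : EReal) = f p := by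
  obtain ⟨y, hy⟩ := hf.2
  refine EReal.coe_toReal (fun hpt => ?_) (hf.1 p)
  have hle : moreauObjective f lam x p ≤ moreauObjective f lam x y := hp (mem_univ y)
  rw [moreauObjective, hpt, EReal.top_add_coe, top_le_iff] at hle
  exact EReal.add_ne_top hy (EReal.coe_ne_top _) hle

theorem moreauEnvelope_eq_of_isMinOn (hf : IsProperFun f)
    (hp : IsMinOn (moreauObjective f lam x) univ p) :
    moreauEnvelope f lam x = (f p).toReal + 1 / (2 * lam) * ‖x - p‖ ^ 2 := by
  have hinf : ⨅ ξ, moreauObjective f lam x ξ = moreauObjective f lam x p :=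
    le_antisymm (iInf_le _ p) (le_iInf fun ξ => hp (mem_univ ξ))
  rw [moreauEnvelope, hinf, moreauObjective, ← coe_toReal_of_isMinOn_moreauObjective hf hp,
    ← EReal.coe_add, EReal.toReal_coe, EReal.toReal_coe]

theorem toReal_iInf_le_of_isMinOn_moreauObjective (hf : IsProperFun f)
    (hmin : ∃ z, IsMinOn f univ z) (hp : IsMinOn (moreauObjective f lam x) univ p) :
    (⨅ y, f y).toReal ≤ (f p).toReal := by
  have hle : ⨅ y, f y ≤ f p := iInf_le _ p
  rw [← coe_toReal_iInf hf hmin, ← coe_toReal_of_isMinOn_moreauObjective hf hp] at hle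
  exact_mod_cast hle

theorem toReal_le_moreauEnvelope_of_isMinOn (hf : IsProperFun f) (hlam : 0 < lam)
    (hp : IsMinOn (moreauObjective f lam x) univ p) : (f p).toReal ≤ moreauEnvelope f lam x := by
  rw [moreauEnvelope_eq_of_isMinOn hf hp]
  exact le_add_of_nonneg_right (by positivity)

theorem toReal_iInf_le_moreauEnvelope (hf : IsProperFun f) (hmin : ∃ z, IsMinOn f univ z)
    (hlam : 0 < lam) (x : H) : (⨅ y, f y).toReal ≤ moreauEnvelope f lam x := by
  have hle : ⨅ y, f y ≤ ⨅ ξ, moreauObjective f lam x ξ :=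
    iInf_mono fun ξ => le_moreauObjective hlam x ξ
  rw [← coe_toReal_iInf hf hmin, ← coe_moreauEnvelope hf hmin hlam] at hle
  exact_mod_cast hle

theorem moreauEnvelope_eq_toReal_iInf (hlam : 0 < lam) (hz : IsMinOn f univ z) :
    moreauEnvelope f lam z = (⨅ y, f y).toReal := by
  refine congrArg EReal.toReal (le_antisymm (le_iInf fun y => ?_)
    (iInf_mono fun ξ => le_moreauObjective hlam z ξ))
  calc ⨅ ξ, moreauObjective f lam z ξ ≤ moreauObjective f lam z z := iInf_le _ z
    _ = f z := by simp [moreauObjective]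
    _ ≤ f y := hz (mem_univ y)

theorem isMinOn_moreauEnvelope (hf : IsProperFun f) (hlam : 0 < lam) (hz : IsMinOn f univ z) :
    IsMinOn (moreauEnvelope f lam) univ z := fun x _ => by
  simpa only [mem_ofPred_eq, moreauEnvelope_eq_toReal_iInf hlam hz] using
    toReal_iInf_le_moreauEnvelope hf ⟨z, hz⟩ hlam x

theorem isMinOn_of_isMinOn_moreauEnvelope (hf : IsProperFun f) (hmin : ∃ z, IsMinOn f univ z)
    (hlam : 0 < lam) (hp : IsMinOn (moreauObjective f lam x) univ p)
    (hx : IsMinOn (moreauEnvelope f lam) univ x) : IsMinOn f univ x := by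
  obtain ⟨z, hz⟩ := hmin
  have hle : moreauEnvelope f lam x ≤ (⨅ y, f y).toReal :=
    (hx (mem_univ z)).trans_eq (moreauEnvelope_eq_toReal_iInf hlam hz)
  have hinf := toReal_iInf_le_of_isMinOn_moreauObjective hf ⟨z, hz⟩ hp
  rw [moreauEnvelope_eq_of_isMinOn hf hp] at hle
  have hsq : 1 / (2 * lam) * ‖x - p‖ ^ 2 = 0 := le_antisymm (by linarith) (by positivity)
  obtain rfl : x = p := by simpa [hlam.ne', sub_eq_zero] using hsq
  have hfx : f x = ⨅ y, f y := by
    rw [← coe_toReal_of_isMinOn_moreauObjective hf hp, ← coe_toReal_iInf hf ⟨z, hz⟩]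
    exact_mod_cast le_antisymm (by linarith) hinf
  exact fun y _ => hfx.trans_le (iInf_le _ y)

theorem isBigO_toReal_sub_iInf {ι : Type*} {l : Filter ι} {ξ q : ι → H} (hf : IsProperFun f)
    (hmin : ∃ z, IsMinOn f univ z) (hlam : 0 < lam)
    (hq : ∀ i, IsMinOn (moreauObjective f lam (ξ i)) univ (q i)) :
    (fun i => (f (q i)).toReal - (⨅ y, f y).toReal) =O[l]
      fun i => moreauEnvelope f lam (ξ i) - (⨅ y, f y).toReal := by
  refine isBigO_of_le l fun i => ?_
  have hlow := toReal_iInf_le_of_isMinOn_moreauObjective hf hmin (hq i)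
  have hupp := toReal_le_moreauEnvelope_of_isMinOn hf hlam (hq i)
  rw [Real.norm_of_nonneg (by linarith), Real.norm_of_nonneg (by linarith)]
  linarith

variable [InnerProductSpace ℝ H]

theorem convexOn_moreauEnvelope (hf : IsProperFun f) (hc : IsConvexFun f)
    (hmin : ∃ z, IsMinOn f univ z) (hlam : 0 < lam)
    (hatt : ∀ x, ∃ p, IsMinOn (moreauObjective f lam x) univ p) :
    ConvexOn ℝ univ (moreauEnvelope f lam) := by
  refine convexOn_iff_forall_pos.2 ⟨convex_univ, fun x _ y _ a b ha hb hab => ?_⟩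
  obtain ⟨p, hp⟩ := hatt x
  obtain ⟨q, hq⟩ := hatt y
  have hfpq : f (a • p + b • q) ≤ ((a * (f p).toReal + b * (f q).toReal : ℝ) : EReal) := by
    have hjensen := hc p q a b ha hb hab
    rw [← coe_toReal_of_isMinOn_moreauObjective hf hp,
      ← coe_toReal_of_isMinOn_moreauObjective hf hq] at hjensen
    exact_mod_cast hjensen
  have hsq : ‖a • (x - p) + b • (y - q)‖ ^ 2 ≤ a * ‖x - p‖ ^ 2 + b * ‖y - q‖ ^ 2 :=
    ((convexOn_norm convex_univ).pow (fun _ _ => norm_nonneg _) 2).2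
      (mem_univ (x - p)) (mem_univ (y - q)) ha.le hb.le hab
  calc moreauEnvelope f lam (a • x + b • y)
      ≤ a * (f p).toReal + b * (f q).toReal
        + 1 / (2 * lam) * ‖a • x + b • y - (a • p + b • q)‖ ^ 2 :=
        moreauEnvelope_le hf hmin hlam _ hfpq
    _ = a * (f p).toReal + b * (f q).toReal
        + 1 / (2 * lam) * ‖a • (x - p) + b • (y - q)‖ ^ 2 := by congr 4; module
    _ ≤ a * (f p).toReal + b * (f q).toReal
        + 1 / (2 * lam) * (a * ‖x - p‖ ^ 2 + b * ‖y - q‖ ^ 2) := by gcongr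
    _ = a • moreauEnvelope f lam x + b • moreauEnvelope f lam y := by
        rw [moreauEnvelope_eq_of_isMinOn hf hp, moreauEnvelope_eq_of_isMinOn hf hq, smul_eq_mul,
          smul_eq_mul]
        ring

theorem moreauEnvelope_add_le_quadratic (hf : IsProperFun f) (hmin : ∃ z, IsMinOn f univ z)
    (hlam : 0 < lam) (hp : IsMinOn (moreauObjective f lam x) univ p) (h : H) :
    moreauEnvelope f lam (x + h) ≤ moreauEnvelope f lam x + ⟪(1 / lam) • (x - p), h⟫
      + 1 / (2 * lam) * ‖h‖ ^ 2 :=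
  calc moreauEnvelope f lam (x + h) ≤ (f p).toReal + 1 / (2 * lam) * ‖x + h - p‖ ^ 2 :=
        moreauEnvelope_le hf hmin hlam _ (coe_toReal_of_isMinOn_moreauObjective hf hp).ge
    _ = (f p).toReal + 1 / (2 * lam) * (‖x - p‖ ^ 2 + 2 * ⟪x - p, h⟫ + ‖h‖ ^ 2) := by
        rw [add_sub_right_comm, norm_add_sq_real]
    _ = moreauEnvelope f lam x + ⟪(1 / lam) • (x - p), h⟫ + 1 / (2 * lam) * ‖h‖ ^ 2 := by
        rw [moreauEnvelope_eq_of_isMinOn hf hp, real_inner_smul_left]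
        field_simp
        ring

theorem hasGradientAt_moreauEnvelope [CompleteSpace H] (hf : IsProperFun f) (hc : IsConvexFun f)
    (hmin : ∃ z, IsMinOn f univ z) (hlam : 0 < lam)
    (hatt : ∀ x, ∃ p, IsMinOn (moreauObjective f lam x) univ p)
    (hp : IsMinOn (moreauObjective f lam x) univ p) :
    HasGradientAt (moreauEnvelope f lam) ((1 / lam) • (x - p)) x :=
  hasGradientAt_of_convexOn_of_le_quadratic (convexOn_moreauEnvelope hf hc hmin hlam hatt)
    (moreauEnvelope_add_le_quadratic hf hmin hlam hp)

end MoreauEnvelope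

section Asymptotics

theorem exists_tendsto_atTop_of_antitoneOn_Ici {e : ℝ → ℝ} {T b : ℝ} (he : AntitoneOn e (Ici T))
    (hb : ∀ t ∈ Ici T, b ≤ e t) : ∃ l, Tendsto e atTop (𝓝 l) := by
  have hanti : Antitone fun t => e (max T t) := fun s t hst =>
    he (le_max_left T s) (le_max_left T t) (max_le_max le_rfl hst)
  have hbdd : BddBelow (range fun t => e (max T t)) :=
    ⟨b, forall_mem_range.2 fun t => hb _ (le_max_left T t)⟩
  refine ⟨_, (tendsto_atTop_ciInf hanti hbdd).congr' ?_⟩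
  filter_upwards [eventually_ge_atTop T] with t ht
  rw [max_eq_right ht]

theorem antitoneOn_Ici_of_deriv_nonpos {e : ℝ → ℝ} {T : ℝ}
    (hd : ∀ t ∈ Ici T, DifferentiableAt ℝ e t) (hle : ∀ t ∈ Ici T, deriv e t ≤ 0) :
    AntitoneOn e (Ici T) :=
  antitoneOn_of_deriv_nonpos (convex_Ici T)
    (fun t ht => (hd t ht).continuousAt.continuousWithinAt)
    (fun t ht => (hd t (interior_subset ht)).differentiableWithinAt)
    fun t ht => hle t (interior_subset ht)

theorem not_eventually_deriv_le_neg_div {e : ℝ → ℝ} {b c : ℝ} (hc : 0 < c)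
    (hd : ∀ᶠ t in atTop, DifferentiableAt ℝ e t) (hb : ∀ᶠ t in atTop, b ≤ e t) :
    ¬ ∀ᶠ t in atTop, deriv e t ≤ -c / t := by
  intro hle
  obtain ⟨T, hT⟩ := eventually_atTop.1 (((hd.and hle).and hb).and (eventually_gt_atTop 0))
  have hderiv : ∀ t ∈ Ici T,
      HasDerivAt (fun t => e t + c * Real.log t) (deriv e t + c * t⁻¹) t := fun t ht =>
    (hT t ht).1.1.1.hasDerivAt.add ((Real.hasDerivAt_log (hT t ht).2.ne').const_mul c)
  have hanti : AntitoneOn (fun t => e t + c * Real.log t) (Ici T) := by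
    refine antitoneOn_Ici_of_deriv_nonpos (fun t ht => (hderiv t ht).differentiableAt)
      fun t ht => ?_
    have hle' := (hT t ht).1.1.2
    rw [neg_div, div_eq_mul_inv] at hle'
    rw [(hderiv t ht).deriv]
    linarith
  obtain ⟨t, hlog, ht⟩ := (((Real.tendsto_log_atTop.const_mul_atTop hc).eventually_gt_atTop
    (e T + c * Real.log T - b)).and (eventually_ge_atTop T)).exists
  have hmono : e t + c * Real.log t ≤ e T + c * Real.log T := hanti self_mem_Ici ht ht
  have hbt := (hT t ht).1.2
  linarith

section AddMulDeriv

variable {y y' ψ : ℝ → ℝ} {q : ℝ}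

theorem eventually_le_of_add_mul_deriv_le {c c' : ℝ} (hq : 0 < q)
    (hd : ∀ᶠ t in atTop, HasDerivAt y (y' t) t)
    (hle : ∀ᶠ t in atTop, y t + t / q * y' t ≤ c) (hcc : c < c') : ∀ᶠ t in atTop, y t ≤ c' := by
  obtain ⟨T, hT⟩ := eventually_atTop.1 ((hd.and hle).and (eventually_gt_atTop 0))
  have hderiv : ∀ t ∈ Ici T, HasDerivAt (fun t => t ^ q * (y t - c))
      (q * t ^ (q - 1) * (y t + t / q * y' t - c)) t := fun t ht => by
    have ht0 : 0 < t := (hT t ht).2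
    refine ((Real.hasDerivAt_rpow_const (.inl ht0.ne')).fun_mul
      ((hT t ht).1.1.sub_const c)).congr_deriv ?_
    rw [Real.rpow_sub_one ht0.ne']
    field_simp
    ring
  have hanti : AntitoneOn (fun t => t ^ q * (y t - c)) (Ici T) := by
    refine antitoneOn_Ici_of_deriv_nonpos (fun t ht => (hderiv t ht).differentiableAt)
      fun t ht => ?_
    have ht0 : 0 < t := (hT t ht).2
    rw [(hderiv t ht).deriv]
    exact mul_nonpos_of_nonneg_of_nonpos (by positivity) (sub_nonpos.2 (hT t ht).1.2)
  filter_upwards [eventually_ge_atTop T, ((tendsto_rpow_atTop hq).const_mul_atTop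
    (sub_pos.2 hcc)).eventually_ge_atTop (T ^ q * (y T - c))] with t ht hlarge
  have ht0 : 0 < t := (hT t ht).2
  have hmul : t ^ q * (y t - c) ≤ t ^ q * (c' - c) :=
    calc t ^ q * (y t - c) ≤ T ^ q * (y T - c) := hanti self_mem_Ici ht ht
      _ ≤ (c' - c) * t ^ q := hlarge
      _ = t ^ q * (c' - c) := mul_comm _ _
  linarith [le_of_mul_le_mul_left hmul (by positivity)]

theorem tendsto_of_tendsto_add_mul_deriv {l : ℝ} (hq : 0 < q)
    (hd : ∀ᶠ t in atTop, HasDerivAt y (y' t) t)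
    (hl : Tendsto (fun t => y t + t / q * y' t) atTop (𝓝 l)) : Tendsto y atTop (𝓝 l) := by
  refine tendsto_order.2 ⟨fun a ha => ?_, fun b hb => ?_⟩
  · obtain ⟨a', haa', ha'l⟩ := exists_between ha
    obtain ⟨a'', ha'a'', ha''l⟩ := exists_between ha'l
    have hneg : ∀ᶠ t in atTop, -y t ≤ -a' := by
      refine eventually_le_of_add_mul_deriv_le (y' := fun t => -y' t) hq
        (hd.mono fun t ht => ht.neg) ?_ (neg_lt_neg ha'a'')
      filter_upwards [hl.eventually_const_le ha''l] with t ht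
      linarith
    filter_upwards [hneg] with t ht
    linarith
  · obtain ⟨b', hlb', hb'b⟩ := exists_between hb
    obtain ⟨b'', hlb'', hb''b'⟩ := exists_between hlb'
    filter_upwards [eventually_le_of_add_mul_deriv_le hq hd (hl.eventually_le_const hlb'') hb''b']
      with t ht using ht.trans_lt hb'b

theorem eventually_le_div_pow_of_add_mul_deriv_le {c c' : ℝ} {k : ℕ} (hkq : k < q)
    (hd : ∀ᶠ t in atTop, HasDerivAt y (y' t) t)
    (hle : ∀ᶠ t in atTop, y t + t / q * y' t ≤ c / t ^ k) (hcc : q / (q - k) * c < c') :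
    ∀ᶠ t in atTop, y t ≤ c' / t ^ k := by
  have hq : 0 < q := (Nat.cast_nonneg k).trans_lt hkq
  have hqk : 0 < q - k := sub_pos.2 hkq
  have hpow : ∀ᶠ t in atTop, t ^ k * y t ≤ c' := by
    refine eventually_le_of_add_mul_deriv_le hqk
      (hd.mono fun t ht => (hasDerivAt_pow k t).fun_mul ht) ?_ hcc
    filter_upwards [hle, eventually_gt_atTop 0] with t ht ht0
    have hk : t * (k * t ^ (k - 1)) = k * t ^ k := by
      cases k <;> simp [pow_succ]; ring
    calc t ^ k * y t + t / (q - k) * (k * t ^ (k - 1) * y t + t ^ k * y' t)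
        = t ^ k * y t + (t * (k * t ^ (k - 1)) * y t + t * t ^ k * y' t) / (q - k) := by ring
      _ = q / (q - k) * (t ^ k * (y t + t / q * y' t)) := by rw [hk]; field_simp; ring
      _ ≤ q / (q - k) * c := by
          gcongr
          rwa [le_div_iff₀' (by positivity)] at ht
  filter_upwards [hpow, eventually_gt_atTop 0] with t ht ht0
  rwa [le_div_iff₀' (by positivity)]

variable {k : ℕ}

theorem isBigO_of_add_mul_deriv_le (hkq : k < q) (hd : ∀ᶠ t in atTop, HasDerivAt y (y' t) t)
    (hy : ∀ᶠ t in atTop, 0 ≤ y t) (hle : ∀ᶠ t in atTop, y t + t / q * y' t ≤ ψ t)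
    (hψ : ψ =O[atTop] fun t => 1 / t ^ k) : y =O[atTop] fun t => 1 / t ^ k := by
  obtain ⟨c, hc⟩ := hψ.bound
  have hbound : ∀ᶠ t in atTop, y t + t / q * y' t ≤ c / t ^ k := by
    filter_upwards [hle, hc, eventually_gt_atTop 0] with t ht hct ht0
    rw [Real.norm_of_nonneg (r := 1 / t ^ k) (by positivity), mul_one_div] at hct
    exact ht.trans ((le_abs_self _).trans hct)
  refine IsBigO.of_bound (q / (q - k) * c + 1) ?_
  filter_upwards [hy, eventually_gt_atTop 0,
    eventually_le_div_pow_of_add_mul_deriv_le hkq hd hbound (lt_add_one _)] with t hyt ht0 ht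
  rwa [Real.norm_of_nonneg hyt, Real.norm_of_nonneg (by positivity), mul_one_div]

theorem isLittleO_of_add_mul_deriv_le (hkq : k < q) (hd : ∀ᶠ t in atTop, HasDerivAt y (y' t) t)
    (hy : ∀ᶠ t in atTop, 0 ≤ y t) (hle : ∀ᶠ t in atTop, y t + t / q * y' t ≤ ψ t)
    (hψ : ψ =o[atTop] fun t => 1 / t ^ k) : y =o[atTop] fun t => 1 / t ^ k := by
  have hq : 0 < q := (Nat.cast_nonneg k).trans_lt hkq
  have hqk : 0 < q - k := sub_pos.2 hkq
  refine isLittleO_iff.2 fun ε hε => ?_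
  have hδ : 0 < (q - k) / q * (ε / 2) := by positivity
  have hbound : ∀ᶠ t in atTop, y t + t / q * y' t ≤ ((q - k) / q * (ε / 2)) / t ^ k := by
    filter_upwards [hle, isLittleO_iff.1 hψ hδ, eventually_gt_atTop 0] with t ht hct ht0
    rw [Real.norm_of_nonneg (r := 1 / t ^ k) (by positivity), mul_one_div] at hct
    exact ht.trans ((le_abs_self _).trans hct)
  have hlt : q / (q - k) * ((q - k) / q * (ε / 2)) < ε := by
    field_simp
    linarith
  filter_upwards [hy, eventually_gt_atTop 0,
    eventually_le_div_pow_of_add_mul_deriv_le hkq hd hbound hlt] with t hyt ht0 ht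
  rwa [Real.norm_of_nonneg hyt, Real.norm_of_nonneg (by positivity), mul_one_div]

end AddMulDeriv

end Asymptotics

section WeakConvergence

open scoped RealInnerProductSpace

theorem mem_of_mapClusterPt_toWeakSpace {E ι : Type*} [NormedAddCommGroup E] [NormedSpace ℝ E]
    {l : Filter ι} {v : ι → E} {p : E} {s : Set E} (hc : Convex ℝ s) (hs : IsClosed s)
    (hv : ∀ᶠ t in l, v t ∈ s)
    (hp : MapClusterPt (toWeakSpace ℝ E p) l fun t => toWeakSpace ℝ E (v t)) : p ∈ s := by
  have hclosed : IsClosed (toWeakSpace ℝ E '' s) := by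
    rw [← closure_eq_iff_isClosed, ← hc.toWeakSpace_closure ℝ, hs.closure_eq]
  exact ((toWeakSpace ℝ E).injective.mem_set_image).1
    (hclosed.mem_of_mapClusterPt hp (hv.mono fun t ht => mem_image_of_mem _ ht))

variable {H : Type*} [NormedAddCommGroup H] [InnerProductSpace ℝ H]

theorem continuous_inner_toWeakSpace_symm (y : H) :
    Continuous fun x : WeakSpace ℝ H => ⟪y, (toWeakSpace ℝ H).symm x⟫ :=
  WeakBilin.eval_continuous (topDualPairing ℝ H).flip (innerSL ℝ y)

theorem eq_of_mapClusterPt_toWeakSpace {ι : Type*} {l : Filter ι} {v : ι → H} {p q : H} {c d : ℝ}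
    (hp : MapClusterPt (toWeakSpace ℝ H p) l fun t => toWeakSpace ℝ H (v t))
    (hq : MapClusterPt (toWeakSpace ℝ H q) l fun t => toWeakSpace ℝ H (v t))
    (hpd : Tendsto (fun t => ‖v t - p‖) l (𝓝 c)) (hqd : Tendsto (fun t => ‖v t - q‖) l (𝓝 d)) :
    p = q := by
  have hlim : Tendsto (fun t => ⟪p - q, v t⟫) l
      (𝓝 ((d ^ 2 - c ^ 2 + ‖p‖ ^ 2 - ‖q‖ ^ 2) / 2)) := by
    refine (((((hqd.pow 2).sub (hpd.pow 2)).add_const (‖p‖ ^ 2)).sub_const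
      (‖q‖ ^ 2)).div_const 2).congr fun t => ?_
    rw [norm_sub_sq_real, norm_sub_sq_real, inner_sub_left, real_inner_comm p, real_inner_comm q]
    ring
  have heq : ∀ {x}, MapClusterPt (toWeakSpace ℝ H x) l (fun t => toWeakSpace ℝ H (v t)) →
      ⟪p - q, x⟫ = (d ^ 2 - c ^ 2 + ‖p‖ ^ 2 - ‖q‖ ^ 2) / 2 := fun {x} hx => by
    have hmap : MapClusterPt ⟪p - q, x⟫ l fun t => ⟪p - q, v t⟫ :=
      hx.continuousAt_comp
        (f := fun x : WeakSpace ℝ H => ⟪p - q, (toWeakSpace ℝ H).symm x⟫)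
        (continuous_inner_toWeakSpace_symm (p - q)).continuousAt
    exact eq_of_nhds_neBot (hmap.clusterPt.mono hlim)
  have hself : ⟪p - q, p - q⟫ = 0 := by rw [inner_sub_right, heq hp, heq hq, sub_self]
  exact sub_eq_zero.1 (inner_self_eq_zero.1 hself)

variable [CompleteSpace H]

theorem tendsto_toWeakSpace_iff {ι : Type*} {l : Filter ι} {v : ι → H} {p : H} :
    Tendsto (fun t => toWeakSpace ℝ H (v t)) l (𝓝 (toWeakSpace ℝ H p)) ↔
      ∀ y, Tendsto (fun t => ⟪y, v t⟫) l (𝓝 ⟪y, p⟫) := by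
  have hinj : Function.Injective (topDualPairing ℝ H).flip := fun x x' h =>
    ext_inner_left ℝ fun y => LinearMap.congr_fun h (InnerProductSpace.toDual ℝ H y)
  refine (WeakBilin.tendsto_iff_forall_eval_tendsto _ hinj).trans
    ⟨fun h y => h (InnerProductSpace.toDual ℝ H y), fun h φ => ?_⟩
  have hφ := h ((InnerProductSpace.toDual ℝ H).symm φ)
  simp only [InnerProductSpace.toDual_symm_apply] at hφ
  exact hφ

theorem surjective_inclusionInDoubleDualWeak :
    Function.Surjective (NormedSpace.inclusionInDoubleDualWeak ℝ H) := fun ψ => by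
  let φ : StrongDual ℝ H := (WeakDual.toStrongDual ψ).comp
    (InnerProductSpace.toDual ℝ H).toContinuousLinearEquiv.toContinuousLinearMap
  refine ⟨toWeakSpace ℝ H ((InnerProductSpace.toDual ℝ H).symm φ), DFunLike.ext _ _ fun θ => ?_⟩
  obtain ⟨x, rfl⟩ := (InnerProductSpace.toDual ℝ H).surjective θ
  change ⟪x, (InnerProductSpace.toDual ℝ H).symm φ⟫ = φ x
  rw [real_inner_comm, InnerProductSpace.toDual_symm_apply]

theorem isCompact_closure_toWeakSpace_image {s : Set H} (hs : Bornology.IsBounded s) :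
    IsCompact (closure (toWeakSpace ℝ H '' s)) := by
  refine NormedSpace.isCompact_closure_of_isBounded ℝ H _ ?_
    ((surjective_inclusionInDoubleDualWeak (H := H)).range_eq ▸ subset_univ _)
  rwa [preimage_image_eq _ (toWeakSpace ℝ H).injective]

/-- **Opial's lemma**. -/
theorem exists_tendsto_toWeakSpace_of_tendsto_norm_sub {ι : Type*} {l : Filter ι} [l.NeBot]
    {v : ι → H} {s : Set H} (hs : s.Nonempty)
    (hdist : ∀ z ∈ s, ∃ d, Tendsto (fun t => ‖v t - z‖) l (𝓝 d))
    (hcluster : ∀ p, MapClusterPt (toWeakSpace ℝ H p) l (fun t => toWeakSpace ℝ H (v t)) → p ∈ s) :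
    ∃ p ∈ s, Tendsto (fun t => toWeakSpace ℝ H (v t)) l (𝓝 (toWeakSpace ℝ H p)) := by
  obtain ⟨z, hz⟩ := hs
  obtain ⟨d, hd⟩ := hdist z hz
  have hball : ∀ᶠ t in l, toWeakSpace ℝ H (v t) ∈
      closure (toWeakSpace ℝ H '' Metric.closedBall z (d + 1)) := by
    filter_upwards [hd.eventually_le_const (lt_add_one d)] with t ht
    exact subset_closure (mem_image_of_mem _ (mem_closedBall_iff_norm.2 ht))
  have hcompact := isCompact_closure_toWeakSpace_image
    (Metric.isBounded_closedBall (x := z) (r := d + 1))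
  obtain ⟨p', -, hp'⟩ := hcompact.exists_mapClusterPt_of_frequently hball.frequently
  obtain ⟨p, rfl⟩ := (toWeakSpace ℝ H).surjective p'
  refine ⟨p, hcluster p hp', hcompact.tendsto_nhds_of_unique_mapClusterPt hball fun q' _ hq' => ?_⟩
  obtain ⟨q, rfl⟩ := (toWeakSpace ℝ H).surjective q'
  obtain ⟨c, hc⟩ := hdist p (hcluster p hp')
  obtain ⟨c', hc'⟩ := hdist q (hcluster q hq')
  rw [eq_of_mapClusterPt_toWeakSpace hq' hp' hc' hc]

end WeakConvergence

section Inertial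

open scoped RealInnerProductSpace

/-- A positive time scaling `β` on `[T, ∞)` which grows at most like `t ^ γ`, in the infinitesimal
form `t β' ≤ γ β`. -/
structure IsTimeScaling (β : ℝ → ℝ) (γ T : ℝ) : Prop where
  neg_two_le : -2 ≤ γ
  pos : ∀ t ∈ Ici T, 0 < β t
  differentiableAt : ∀ t ∈ Ici T, DifferentiableAt ℝ β t
  mul_deriv_le : ∀ t ∈ Ici T, t * deriv β t ≤ γ * β t

variable {β : ℝ → ℝ} {a γ ρ T t : ℝ}

theorem IsTimeScaling.mul_gap_nonneg {X : Type*} {G : X → ℝ} {z : X} (hβ : IsTimeScaling β γ T)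
    (hz : IsMinOn G univ z) (ht : t ∈ Ici T) (x : X) : 0 ≤ β t * (G x - G z) :=
  mul_nonneg (hβ.pos t ht).le (sub_nonneg.2 (hz (mem_univ x)))

variable {H : Type*} [NormedAddCommGroup H] {G : H → ℝ} {v w : ℝ → H} {z : H}

/-- The energy of a trajectory `v` with velocity `w` relative to the point `z`, scaled by `t²`, for
the potential `β (t) G`. -/
noncomputable def scaledEnergy (G : H → ℝ) (β : ℝ → ℝ) (v w : ℝ → H) (z : H) (t : ℝ) : ℝ :=
  t ^ 2 * β t * (G (v t) - G z) + t ^ 2 / 2 * ‖w t‖ ^ 2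

theorem sq_mul_gap_le_scaledEnergy :
    t ^ 2 * β t * (G (v t) - G z) ≤ scaledEnergy G β v w z t :=
  le_add_of_nonneg_right (by positivity)

theorem IsTimeScaling.scaledEnergy_nonneg (hβ : IsTimeScaling β γ T) (hz : IsMinOn G univ z)
    (ht : t ∈ Ici T) : 0 ≤ scaledEnergy G β v w z t := by
  have hgap := hβ.mul_gap_nonneg hz ht (v t)
  rw [scaledEnergy, mul_assoc]
  positivity

variable [InnerProductSpace ℝ H]

/-- The part of the Lyapunov function of an inertial system with damping `a / t` that measures the
distance of the trajectory `v`, with velocity `w`, to the anchor `z`. -/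
noncomputable def anchorTerm (a : ℝ) (v w : ℝ → H) (z : H) (t : ℝ) : ℝ :=
  t * ⟪v t - z, w t⟫ + (a - 1) / 2 * ‖v t - z‖ ^ 2

/-- The family, indexed by `ρ`, of Lyapunov functions of an inertial system with damping `a / t` and
time scaling `β`. -/
noncomputable def lyapunov (G : H → ℝ) (a : ℝ) (β : ℝ → ℝ) (v w : ℝ → H) (z : H) (ρ t : ℝ) : ℝ :=
  scaledEnergy G β v w z t + ρ * anchorTerm a v w z t

theorem lyapunov_eq : lyapunov G a β v w z ρ t = t ^ 2 * β t * (G (v t) - G z)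
    + 1 / 2 * ‖ρ • (v t - z) + t • w t‖ ^ 2 + ρ * (a - 1 - ρ) / 2 * ‖v t - z‖ ^ 2 := by
  rw [lyapunov, scaledEnergy, anchorTerm, norm_add_sq_real, norm_smul, norm_smul, mul_pow, mul_pow,
    Real.norm_eq_abs, Real.norm_eq_abs, sq_abs, sq_abs, real_inner_smul_left,
    real_inner_smul_right]
  ring

theorem sq_mul_gap_le_lyapunov (hρ : 0 ≤ ρ) (ha : ρ ≤ a - 1) :
    t ^ 2 * β t * (G (v t) - G z) ≤ lyapunov G a β v w z ρ t := by
  rw [lyapunov_eq, add_assoc]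
  exact le_add_of_nonneg_right (by positivity)

theorem IsTimeScaling.lyapunov_nonneg (hβ : IsTimeScaling β γ T) (hz : IsMinOn G univ z)
    (hρ : 0 ≤ ρ) (ha : ρ ≤ a - 1) (ht : t ∈ Ici T) : 0 ≤ lyapunov G a β v w z ρ t := by
  have hgap := hβ.mul_gap_nonneg hz ht (v t)
  refine le_trans ?_ (sq_mul_gap_le_lyapunov hρ ha)
  rw [mul_assoc]
  positivity

variable [CompleteSpace H]

/-- `v`, with velocity `w`, solves the inertial gradient system
`v'' + (a / t) v' + β (t) ∇G (v) = 0`, with asymptotically vanishing damping and time scaling `β`,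
on `[T, ∞)`. -/
structure IsInertialSolution (G : H → ℝ) (a : ℝ) (β : ℝ → ℝ) (T : ℝ) (v w : ℝ → H) : Prop where
  pos : 0 < T
  hasDerivAt : ∀ t ∈ Ici T, HasDerivAt v (w t) t
  hasDerivAt_velocity : ∀ t ∈ Ici T, HasDerivAt w (-(a / t) • w t - β t • gradient G (v t)) t

namespace IsInertialSolution

theorem hasDerivAt_scaledEnergy (h : IsInertialSolution G a β T v w)
    (hβ : DifferentiableAt ℝ β t) (hG : DifferentiableAt ℝ G (v t)) (z : H) (ht : t ∈ Ici T) :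
    HasDerivAt (scaledEnergy G β v w z)
      ((2 * t * β t + t ^ 2 * deriv β t) * (G (v t) - G z) - (a - 1) * t * ‖w t‖ ^ 2) t := by
  have ht0 : 0 < t := h.pos.trans_le ht
  have hGv : HasDerivAt (fun s => G (v s)) ⟪gradient G (v t), w t⟫ t :=
    hasDerivAt_comp_of_hasGradientAt hG.hasGradientAt (h.hasDerivAt t ht)
  refine (((hasDerivAt_pow 2 t).fun_mul hβ.hasDerivAt).fun_mul (hGv.sub_const (G z))).fun_add
    (((hasDerivAt_pow 2 t).div_const 2).fun_mul
      (h.hasDerivAt_velocity t ht).norm_sq) |>.congr_deriv ?_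
  simp only [inner_sub_right, real_inner_smul_right, real_inner_self_eq_norm_sq,
    real_inner_comm (w t) (gradient G (v t))]
  field_simp
  push_cast
  ring

theorem hasDerivAt_anchorTerm (h : IsInertialSolution G a β T v w) (z : H) (ht : t ∈ Ici T) :
    HasDerivAt (anchorTerm a v w z)
      (t * ‖w t‖ ^ 2 - t * β t * ⟪v t - z, gradient G (v t)⟫) t := by
  have ht0 : 0 < t := h.pos.trans_le ht
  have hsub := (h.hasDerivAt t ht).sub_const z
  refine ((hasDerivAt_id' t).fun_mul (hsub.inner ℝ (h.hasDerivAt_velocity t ht))).fun_add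
    (hsub.norm_sq.const_mul ((a - 1) / 2)) |>.congr_deriv ?_
  simp only [inner_sub_right, real_inner_smul_right, real_inner_self_eq_norm_sq]
  field_simp
  ring

theorem differentiableAt_lyapunov (h : IsInertialSolution G a β T v w) (hβ : IsTimeScaling β γ T)
    (hdiff : Differentiable ℝ G) (ht : t ∈ Ici T) :
    DifferentiableAt ℝ (lyapunov G a β v w z ρ) t :=
  (h.hasDerivAt_scaledEnergy (hβ.differentiableAt t ht) (hdiff _) z ht).differentiableAt.add
    ((h.hasDerivAt_anchorTerm z ht).differentiableAt.const_mul ρ)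

theorem deriv_lyapunov_le (h : IsInertialSolution G a β T v w) (hβ : IsTimeScaling β γ T)
    (hconv : ConvexOn ℝ univ G) (hdiff : Differentiable ℝ G) (hz : IsMinOn G univ z)
    (hρ : 0 ≤ ρ) (ht : t ∈ Ici T) :
    deriv (lyapunov G a β v w z ρ) t ≤
      -((ρ - 2 - γ) * (t * (β t * (G (v t) - G z))) + (a - 1 - ρ) * (t * ‖w t‖ ^ 2)) := by
  have ht0 : 0 < t := h.pos.trans_le ht
  have hgap : 0 ≤ G (v t) - G z := sub_nonneg.2 (hz (mem_univ _))
  have hscale : t * (t * deriv β t) * (G (v t) - G z) ≤ t * (γ * β t) * (G (v t) - G z) := by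
    gcongr ?_ * _
    exact mul_le_mul_of_nonneg_left (hβ.mul_deriv_le t ht) ht0.le
  have hsubgrad : G (v t) - G z ≤ ⟪v t - z, gradient G (v t)⟫ := by
    have htangent := add_inner_le_of_convexOn_of_hasGradientAt hconv (hdiff (v t)).hasGradientAt
      (mem_univ (v t)) (mem_univ z)
    rw [← neg_sub, inner_neg_right, real_inner_comm] at htangent
    linarith
  have hanchor : ρ * (t * β t) * (G (v t) - G z) ≤
      ρ * (t * β t) * ⟪v t - z, gradient G (v t)⟫ := by
    have hβt := (hβ.pos t ht).le
    gcongr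
  have hderiv := (h.hasDerivAt_scaledEnergy (hβ.differentiableAt t ht) (hdiff _) z ht).fun_add
    ((h.hasDerivAt_anchorTerm z ht).const_mul ρ)
  calc deriv (lyapunov G a β v w z ρ) t
      = (2 * t * β t + t ^ 2 * deriv β t) * (G (v t) - G z) - (a - 1) * t * ‖w t‖ ^ 2
        + ρ * (t * ‖w t‖ ^ 2 - t * β t * ⟪v t - z, gradient G (v t)⟫) := hderiv.deriv
    _ ≤ _ := by linarith

theorem antitoneOn_lyapunov (h : IsInertialSolution G a β T v w) (hβ : IsTimeScaling β γ T)
    (hconv : ConvexOn ℝ univ G) (hdiff : Differentiable ℝ G) (hz : IsMinOn G univ z)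
    (hγ : γ + 2 ≤ ρ) (ha : ρ ≤ a - 1) : AntitoneOn (lyapunov G a β v w z ρ) (Ici T) := by
  refine antitoneOn_Ici_of_deriv_nonpos (fun t ht => h.differentiableAt_lyapunov hβ hdiff ht)
    fun t ht => ?_
  have ht0 : 0 < t := h.pos.trans_le ht
  have hρ : 0 ≤ ρ := by linarith [hβ.neg_two_le]
  have hgap := hβ.mul_gap_nonneg hz ht (v t)
  have hγ' : 0 ≤ ρ - 2 - γ := by linarith
  exact (h.deriv_lyapunov_le hβ hconv hdiff hz hρ ht).trans (neg_nonpos.2 (by positivity))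

theorem exists_tendsto_lyapunov (h : IsInertialSolution G a β T v w) (hβ : IsTimeScaling β γ T)
    (hconv : ConvexOn ℝ univ G) (hdiff : Differentiable ℝ G) (hz : IsMinOn G univ z)
    (hγ : γ + 2 ≤ ρ) (ha : ρ ≤ a - 1) : ∃ l, Tendsto (lyapunov G a β v w z ρ) atTop (𝓝 l) :=
  exists_tendsto_atTop_of_antitoneOn_Ici (h.antitoneOn_lyapunov hβ hconv hdiff hz hγ ha)
    fun _ ht => hβ.lyapunov_nonneg hz (by linarith [hβ.neg_two_le]) ha ht

theorem isBigO_gap (h : IsInertialSolution G a β T v w) (hβ : IsTimeScaling β γ T)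
    (hconv : ConvexOn ℝ univ G) (hdiff : Differentiable ℝ G) (hz : IsMinOn G univ z)
    (ha : γ + 3 ≤ a) :
    (fun t => G (v t) - G z) =O[atTop] fun t => 1 / (t ^ 2 * β t) := by
  refine IsBigO.of_bound (lyapunov G a β v w z (a - 1) T) ?_
  filter_upwards [eventually_ge_atTop T] with t ht
  have ht0 : 0 < t := h.pos.trans_le ht
  have hβt := hβ.pos t ht
  have hle : t ^ 2 * β t * (G (v t) - G z) ≤ lyapunov G a β v w z (a - 1) T :=
    (sq_mul_gap_le_lyapunov (by linarith [hβ.neg_two_le]) le_rfl).trans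
      (h.antitoneOn_lyapunov hβ hconv hdiff hz (by linarith) le_rfl self_mem_Ici ht ht)
  rw [Real.norm_of_nonneg (sub_nonneg.2 (hz (mem_univ _))), Real.norm_of_nonneg (by positivity),
    mul_one_div]
  exact (le_div_iff₀' (by positivity)).2 hle

theorem exists_tendsto_anchorTerm (h : IsInertialSolution G a β T v w) (hβ : IsTimeScaling β γ T)
    (hconv : ConvexOn ℝ univ G) (hdiff : Differentiable ℝ G) (hz : IsMinOn G univ z)
    (ha : γ + 3 < a) : ∃ l, Tendsto (anchorTerm a v w z) atTop (𝓝 l) := by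
  obtain ⟨l₁, h₁⟩ := h.exists_tendsto_lyapunov hβ hconv hdiff hz le_rfl (by linarith)
  obtain ⟨l₂, h₂⟩ := h.exists_tendsto_lyapunov hβ hconv hdiff hz (by linarith) le_rfl
  have hne : a - γ - 3 ≠ 0 := by linarith
  refine ⟨_, ((h₂.sub h₁).div_const (a - γ - 3)).congr fun t => ?_⟩
  rw [lyapunov, lyapunov]
  field_simp
  ring

theorem exists_tendsto_scaledEnergy (h : IsInertialSolution G a β T v w)
    (hβ : IsTimeScaling β γ T) (hconv : ConvexOn ℝ univ G) (hdiff : Differentiable ℝ G)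
    (hz : IsMinOn G univ z) (ha : γ + 3 < a) :
    ∃ l, Tendsto (scaledEnergy G β v w z) atTop (𝓝 l) := by
  obtain ⟨l₁, h₁⟩ := h.exists_tendsto_lyapunov hβ hconv hdiff hz (by linarith) le_rfl
  obtain ⟨l₂, h₂⟩ := h.exists_tendsto_anchorTerm hβ hconv hdiff hz ha
  exact ⟨_, (h₁.sub (h₂.const_mul (a - 1))).congr fun t => add_sub_cancel_right _ _⟩

theorem deriv_lyapunov_le_scaledEnergy (h : IsInertialSolution G a β T v w)
    (hβ : IsTimeScaling β γ T) (hconv : ConvexOn ℝ univ G) (hdiff : Differentiable ℝ G)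
    (hz : IsMinOn G univ z) (ha : γ + 3 ≤ a) (ht : t ∈ Ici T) :
    deriv (lyapunov G a β v w z ((γ + a + 1) / 2)) t ≤
      -((a - γ - 3) / 2 * scaledEnergy G β v w z t) / t := by
  have ht0 : 0 < t := h.pos.trans_le ht
  have hw : 0 ≤ (a - γ - 3) / 2 * (t * ‖w t‖ ^ 2 / 2) := mul_nonneg (by linarith) (by positivity)
  calc deriv (lyapunov G a β v w z ((γ + a + 1) / 2)) t
      ≤ -(((γ + a + 1) / 2 - 2 - γ) * (t * (β t * (G (v t) - G z)))
        + (a - 1 - (γ + a + 1) / 2) * (t * ‖w t‖ ^ 2)) :=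
        h.deriv_lyapunov_le hβ hconv hdiff hz (by linarith [hβ.neg_two_le]) ht
    _ ≤ -((a - γ - 3) / 2 * (t * (β t * (G (v t) - G z)) + t * ‖w t‖ ^ 2 / 2)) := by linarith
    _ = -((a - γ - 3) / 2 * scaledEnergy G β v w z t) / t := by
        rw [scaledEnergy]
        field_simp

theorem tendsto_scaledEnergy (h : IsInertialSolution G a β T v w) (hβ : IsTimeScaling β γ T)
    (hconv : ConvexOn ℝ univ G) (hdiff : Differentiable ℝ G) (hz : IsMinOn G univ z)
    (ha : γ + 3 < a) : Tendsto (scaledEnergy G β v w z) atTop (𝓝 0) := by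
  obtain ⟨l, hl⟩ := h.exists_tendsto_scaledEnergy hβ hconv hdiff hz ha
  have hl0 : 0 ≤ l := ge_of_tendsto hl
    ((eventually_ge_atTop T).mono fun t ht => hβ.scaledEnergy_nonneg hz ht)
  obtain rfl | hlpos := hl0.eq_or_lt
  · exact hl
  have hδ : 0 < (a - γ - 3) / 2 := by linarith
  refine absurd ?_ (not_eventually_deriv_le_neg_div (e := lyapunov G a β v w z ((γ + a + 1) / 2))
    (mul_pos hδ (half_pos hlpos))
    ((eventually_ge_atTop T).mono fun t ht => h.differentiableAt_lyapunov hβ hdiff ht)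
    ((eventually_ge_atTop T).mono fun t ht =>
      hβ.lyapunov_nonneg hz (by linarith [hβ.neg_two_le]) (by linarith) ht))
  filter_upwards [eventually_ge_atTop T, hl.eventually_const_le (half_lt_self hlpos)] with t ht hlt
  have ht0 : 0 < t := h.pos.trans_le ht
  refine (h.deriv_lyapunov_le_scaledEnergy hβ hconv hdiff hz ha.le ht).trans ?_
  gcongr

theorem isLittleO_gap (h : IsInertialSolution G a β T v w) (hβ : IsTimeScaling β γ T)
    (hconv : ConvexOn ℝ univ G) (hdiff : Differentiable ℝ G) (hz : IsMinOn G univ z)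
    (ha : γ + 3 < a) :
    (fun t => G (v t) - G z) =o[atTop] fun t => 1 / (t ^ 2 * β t) := by
  refine isLittleO_iff.2 fun ε hε => ?_
  filter_upwards [eventually_ge_atTop T,
    (h.tendsto_scaledEnergy hβ hconv hdiff hz ha).eventually_le_const hε] with t ht hle
  have ht0 : 0 < t := h.pos.trans_le ht
  have hβt := hβ.pos t ht
  rw [Real.norm_of_nonneg (sub_nonneg.2 (hz (mem_univ _))), Real.norm_of_nonneg (by positivity),
    mul_one_div]
  exact (le_div_iff₀' (by positivity)).2 (sq_mul_gap_le_scaledEnergy.trans hle)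

theorem exists_tendsto_norm_sub (h : IsInertialSolution G a β T v w) (hβ : IsTimeScaling β γ T)
    (hconv : ConvexOn ℝ univ G) (hdiff : Differentiable ℝ G) (hz : IsMinOn G univ z)
    (ha : γ + 3 < a) : ∃ d, Tendsto (fun t => ‖v t - z‖) atTop (𝓝 d) := by
  obtain ⟨l, hl⟩ := h.exists_tendsto_anchorTerm hβ hconv hdiff hz ha
  have hq : 0 < a - 1 := by linarith [hβ.neg_two_le]
  have hd : ∀ᶠ t in atTop, HasDerivAt (fun t => (a - 1) / 2 * ‖v t - z‖ ^ 2)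
      ((a - 1) / 2 * (2 * ⟪v t - z, w t⟫)) t :=
    (eventually_ge_atTop T).mono fun t ht =>
      ((h.hasDerivAt t ht).sub_const z).norm_sq.const_mul ((a - 1) / 2)
  have hsq := tendsto_of_tendsto_add_mul_deriv hq hd (hl.congr fun t => by
    rw [anchorTerm]
    field_simp
    ring)
  refine ⟨_, (hsq.div_const ((a - 1) / 2)).sqrt.congr fun t => ?_⟩
  rw [mul_div_cancel_left₀ _ (half_pos hq).ne', Real.sqrt_sq (norm_nonneg _)]

theorem exists_tendsto_toWeakSpace (h : IsInertialSolution G a β T v w) (hβ : IsTimeScaling β γ T)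
    (hβtop : Tendsto (fun t => t ^ 2 * β t) atTop atTop) (hconv : ConvexOn ℝ univ G)
    (hdiff : Differentiable ℝ G) (hz : IsMinOn G univ z) (ha : γ + 3 < a) :
    ∃ p, IsMinOn G univ p ∧
      Tendsto (fun t => toWeakSpace ℝ H (v t)) atTop (𝓝 (toWeakSpace ℝ H p)) := by
  refine exists_tendsto_toWeakSpace_of_tendsto_norm_sub (s := {p | IsMinOn G univ p}) ⟨z, hz⟩
    (fun q hq => h.exists_tendsto_norm_sub hβ hconv hdiff hq ha) fun p hp => ?_
  have hgap : Tendsto (fun t => G (v t) - G z) atTop (𝓝 0) :=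
    (h.isBigO_gap hβ hconv hdiff hz ha.le).trans_tendsto
      (by simpa only [one_div, Pi.inv_def] using hβtop.inv_tendsto_atTop)
  have hle : ∀ c > G z, G p ≤ c := fun c hc => by
    have hconvex : Convex ℝ {x | G x ≤ c} := by simpa using hconv.convex_le c
    refine mem_of_mapClusterPt_toWeakSpace (s := {x | G x ≤ c}) hconvex
      (isClosed_le hdiff.continuous continuous_const) ?_ hp
    filter_upwards [hgap.eventually_le_const (sub_pos.2 hc)] with t ht
    exact (sub_le_sub_iff_right (G z)).1 ht
  exact fun x _ => (le_of_forall_gt_imp_ge_of_dense hle).trans (hz (mem_univ x))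

end IsInertialSolution

end Inertial

section Toges

open scoped RealInnerProductSpace

variable {H : Type*} [NormedAddCommGroup H] [InnerProductSpace ℝ H]
  {G : H → ℝ} {α t t₀ : ℝ} {u : ℝ → H} {z : H}

/-- The trajectory `u + (t / 4) u'` at which the third-order equation evaluates the gradient; the
derivative is taken within `[t₀, ∞)`, as in `IsTogesVSolution`. -/
noncomputable def extrapolated (u : ℝ → H) (t₀ t : ℝ) : H :=
  u t + (t / 4) • derivWithin u (Ici t₀) t

theorem isTimeScaling_div_four {T : ℝ} (hT : 0 < T) : IsTimeScaling (fun t => t / 4) 1 T where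
  neg_two_le := by norm_num
  pos t ht := div_pos (hT.trans_le ht) four_pos
  differentiableAt t _ := differentiableAt_id.div_const 4
  mul_deriv_le t _ := by simp [div_eq_mul_inv]

theorem isBigO_one_div_sq_mul_div_four :
    (fun t : ℝ => 1 / (t ^ 2 * (t / 4))) =O[atTop] fun t => 1 / t ^ 3 :=
  IsBigO.of_bound 4 (.of_forall fun t => le_of_eq <| by
    rw [show 1 / (t ^ 2 * (t / 4)) = 4 * (1 / t ^ 3) by field_simp, norm_mul, Real.norm_ofNat])

variable [CompleteSpace H]

theorem gap_add_mul_inner_le_gap_extrapolated (hconv : ConvexOn ℝ univ G)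
    (hdiff : Differentiable ℝ G) (z : H) (t : ℝ) :
    G (u t) - G z + t / 4 * ⟪gradient G (u t), derivWithin u (Ici t₀) t⟫
      ≤ G (extrapolated u t₀ t) - G z := by
  have hsub := add_inner_le_of_convexOn_of_hasGradientAt hconv (hdiff (u t)).hasGradientAt
    (mem_univ _) (mem_univ (extrapolated u t₀ t))
  rw [extrapolated, add_sub_cancel_left, real_inner_smul_right] at hsub
  rw [extrapolated]
  linarith

namespace IsTogesVSolution

theorem hasDerivAt_iteratedDerivWithin (hu : IsTogesVSolution G α t₀ u) {n : ℕ} (hn : n < 3)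
    (ht : t₀ < t) :
    HasDerivAt (iteratedDerivWithin n u (Ici t₀)) (iteratedDerivWithin (n + 1) u (Ici t₀) t) t := by
  have hdiff := hu.contDiffOn.differentiableOn_iteratedDerivWithin (m := n) (by exact_mod_cast hn)
    (uniqueDiffOn_Ici t₀) t ht.le
  rw [iteratedDerivWithin_succ]
  exact hdiff.hasDerivWithinAt.hasDerivAt (Ici_mem_nhds ht)

theorem hasDerivAt (hu : IsTogesVSolution G α t₀ u) (ht : t₀ < t) :
    HasDerivAt u (derivWithin u (Ici t₀) t) t := by
  simpa only [iteratedDerivWithin_zero, zero_add, iteratedDerivWithin_one] using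
    hu.hasDerivAt_iteratedDerivWithin (n := 0) (by norm_num) ht

theorem hasDerivAt_derivWithin (hu : IsTogesVSolution G α t₀ u) (ht : t₀ < t) :
    HasDerivAt (derivWithin u (Ici t₀)) (iteratedDerivWithin 2 u (Ici t₀) t) t := by
  have hd := hu.hasDerivAt_iteratedDerivWithin (n := 1) (by norm_num) ht
  rwa [iteratedDerivWithin_one] at hd

theorem isInertialSolution (hu : IsTogesVSolution G α t₀ u) {T : ℝ} (hT : 0 < T) (hT₀ : t₀ < T) :
    IsInertialSolution G (α + 1) (fun t => t / 4) T (extrapolated u t₀) fun t =>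
      (5 / 4 : ℝ) • derivWithin u (Ici t₀) t + (t / 4) • iteratedDerivWithin 2 u (Ici t₀) t where
  pos := hT
  hasDerivAt t ht := by
    have ht₀ : t₀ < t := hT₀.trans_le ht
    refine ((hu.hasDerivAt ht₀).fun_add (((hasDerivAt_id' t).div_const 4).fun_smul
      (hu.hasDerivAt_derivWithin ht₀))).congr_deriv ?_
    module
  hasDerivAt_velocity t ht := by
    have ht₀ : t₀ < t := hT₀.trans_le ht
    have ht0 : t ≠ 0 := (hT.trans_le ht).ne'
    refine (((hu.hasDerivAt_derivWithin ht₀).fun_const_smul (5 / 4 : ℝ)).fun_add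
      (((hasDerivAt_id' t).div_const 4).fun_smul
        (hu.hasDerivAt_iteratedDerivWithin (n := 2) (by norm_num) ht₀))).congr_deriv ?_
    rw [extrapolated, eq_neg_of_add_eq_zero_right (hu.equation t ht₀.le)]
    match_scalars <;> field_simp <;> ring

theorem isBigO_extrapolated (hu : IsTogesVSolution G α t₀ u) (ht₀ : 0 < t₀)
    (hconv : ConvexOn ℝ univ G) (hdiff : Differentiable ℝ G) (hz : IsMinOn G univ z)
    (hα : 3 ≤ α) :
    (fun t => G (extrapolated u t₀ t) - G z) =O[atTop] fun t => 1 / t ^ 3 := by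
  have hT : 0 < t₀ + 1 := by positivity
  exact ((hu.isInertialSolution hT (lt_add_one t₀)).isBigO_gap (isTimeScaling_div_four hT) hconv
    hdiff hz (by linarith)).trans isBigO_one_div_sq_mul_div_four

theorem isLittleO_extrapolated (hu : IsTogesVSolution G α t₀ u) (ht₀ : 0 < t₀)
    (hconv : ConvexOn ℝ univ G) (hdiff : Differentiable ℝ G) (hz : IsMinOn G univ z)
    (hα : 3 < α) :
    (fun t => G (extrapolated u t₀ t) - G z) =o[atTop] fun t => 1 / t ^ 3 := by
  have hT : 0 < t₀ + 1 := by positivity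
  exact ((hu.isInertialSolution hT (lt_add_one t₀)).isLittleO_gap (isTimeScaling_div_four hT) hconv
    hdiff hz (by linarith)).trans_isBigO isBigO_one_div_sq_mul_div_four

theorem hasDerivAt_gap (hu : IsTogesVSolution G α t₀ u) (hdiff : Differentiable ℝ G) (z : H)
    (ht : t₀ < t) :
    HasDerivAt (fun t => G (u t) - G z) ⟪gradient G (u t), derivWithin u (Ici t₀) t⟫ t :=
  (hasDerivAt_comp_of_hasGradientAt (hdiff (u t)).hasGradientAt (hu.hasDerivAt ht)).sub_const (G z)

theorem isBigO (hu : IsTogesVSolution G α t₀ u) (ht₀ : 0 < t₀)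
    (hconv : ConvexOn ℝ univ G) (hdiff : Differentiable ℝ G) (hz : IsMinOn G univ z)
    (hα : 3 ≤ α) : (fun t => G (u t) - G z) =O[atTop] fun t => 1 / t ^ 3 :=
  isBigO_of_add_mul_deriv_le (by norm_num)
    ((eventually_gt_atTop t₀).mono fun _ ht => hu.hasDerivAt_gap hdiff z ht)
    (.of_forall fun _ => sub_nonneg.2 (hz (mem_univ _)))
    (.of_forall fun t => gap_add_mul_inner_le_gap_extrapolated hconv hdiff z t)
    (hu.isBigO_extrapolated ht₀ hconv hdiff hz hα)

theorem isLittleO (hu : IsTogesVSolution G α t₀ u) (ht₀ : 0 < t₀)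
    (hconv : ConvexOn ℝ univ G) (hdiff : Differentiable ℝ G) (hz : IsMinOn G univ z)
    (hα : 3 < α) : (fun t => G (u t) - G z) =o[atTop] fun t => 1 / t ^ 3 :=
  isLittleO_of_add_mul_deriv_le (by norm_num)
    ((eventually_gt_atTop t₀).mono fun _ ht => hu.hasDerivAt_gap hdiff z ht)
    (.of_forall fun _ => sub_nonneg.2 (hz (mem_univ _)))
    (.of_forall fun t => gap_add_mul_inner_le_gap_extrapolated hconv hdiff z t)
    (hu.isLittleO_extrapolated ht₀ hconv hdiff hz hα)

theorem exists_tendsto_toWeakSpace (hu : IsTogesVSolution G α t₀ u) (ht₀ : 0 < t₀)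
    (hconv : ConvexOn ℝ univ G) (hdiff : Differentiable ℝ G) (hz : IsMinOn G univ z)
    (hα : 3 < α) :
    ∃ p, IsMinOn G univ p ∧
      Tendsto (fun t => toWeakSpace ℝ H (u t)) atTop (𝓝 (toWeakSpace ℝ H p)) := by
  have hT : 0 < t₀ + 1 := by positivity
  have htop : Tendsto (fun t : ℝ => t ^ 2 * (t / 4)) atTop atTop :=
    (tendsto_pow_atTop two_ne_zero).atTop_mul_atTop₀ (tendsto_id.atTop_div_const four_pos)
  obtain ⟨p, hp, hlim⟩ := (hu.isInertialSolution hT (lt_add_one t₀)).exists_tendsto_toWeakSpace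
    (isTimeScaling_div_four hT) htop hconv hdiff hz (by linarith)
  refine ⟨p, hp, tendsto_toWeakSpace_iff.2 fun y => ?_⟩
  refine tendsto_of_tendsto_add_mul_deriv (y' := fun t => ⟪y, derivWithin u (Ici t₀) t⟫)
    four_pos ?_ ?_
  · filter_upwards [eventually_gt_atTop t₀] with t ht
    simpa using (hasDerivAt_const t y).inner ℝ (hu.hasDerivAt ht)
  · simpa only [extrapolated, inner_add_right, real_inner_smul_right] using
      tendsto_toWeakSpace_iff.1 hlim y

end IsTogesVSolution

end Toges

theorem theorem6p1 {H : Type*} [NormedAddCommGroup H] [InnerProductSpace ℝ H] [CompleteSpace H]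
    (f : H → EReal) (hproper : IsProperFun f) (hconvex : IsConvexFun f)
    (hlsc : LowerSemicontinuous f) (hmin : ∃ z, IsMinOn f univ z)
    (lam : ℝ) (hlam : 0 < lam) (α t₀ : ℝ) (ht₀ : 0 < t₀)
    (u : ℝ → H) (hu : IsTogesVSolution (moreauEnvelope f lam) α t₀ u) :
    (3 ≤ α →
      ((fun t : ℝ => moreauEnvelope f lam (u t + (t / 4) • derivWithin u (Ici t₀) t)
          - (⨅ x, f x).toReal) =O[atTop] fun t : ℝ => 1 / t ^ 3) ∧
      ((fun t : ℝ => (f (prox f lam (u t + (t / 4) • derivWithin u (Ici t₀) t))).toReal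
          - (⨅ x, f x).toReal) =O[atTop] fun t : ℝ => 1 / t ^ 3) ∧
      ((fun t : ℝ => moreauEnvelope f lam (u t) - (⨅ x, f x).toReal)
          =O[atTop] fun t : ℝ => 1 / t ^ 3) ∧
      ((fun t : ℝ => (f (prox f lam (u t))).toReal - (⨅ x, f x).toReal)
          =O[atTop] fun t : ℝ => 1 / t ^ 3)) ∧
    (3 < α →
      ((fun t : ℝ => moreauEnvelope f lam (u t + (t / 4) • derivWithin u (Ici t₀) t)
          - (⨅ x, f x).toReal) =o[atTop] fun t : ℝ => 1 / t ^ 3) ∧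
      ((fun t : ℝ => (f (prox f lam (u t + (t / 4) • derivWithin u (Ici t₀) t))).toReal
          - (⨅ x, f x).toReal) =o[atTop] fun t : ℝ => 1 / t ^ 3) ∧
      ((fun t : ℝ => moreauEnvelope f lam (u t) - (⨅ x, f x).toReal)
          =o[atTop] fun t : ℝ => 1 / t ^ 3) ∧
      ((fun t : ℝ => (f (prox f lam (u t))).toReal - (⨅ x, f x).toReal)
          =o[atTop] fun t : ℝ => 1 / t ^ 3) ∧
      ∃ uInf : H, Tendsto (fun t : ℝ => toWeakSpace ℝ H (u t)) atTop (𝓝 (toWeakSpace ℝ H uInf)) ∧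
        IsMinOn f univ uInf) := by
  have hprox := isMinOn_prox hproper hconvex hlsc hmin hlam
  have hatt (x : H) : ∃ p, IsMinOn (moreauObjective f lam x) univ p := ⟨_, hprox x⟩
  have hconv := convexOn_moreauEnvelope hproper hconvex hmin hlam hatt
  have hdiff : Differentiable ℝ (moreauEnvelope f lam) := fun x =>
    (hasGradientAt_moreauEnvelope hproper hconvex hmin hlam hatt (hprox x)).differentiableAt
  have hdom (x : ℝ → H) : (fun t => (f (prox f lam (x t))).toReal - (⨅ y, f y).toReal)
      =O[atTop] fun t => moreauEnvelope f lam (x t) - (⨅ y, f y).toReal :=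
    isBigO_toReal_sub_iInf hproper hmin hlam fun t => hprox (x t)
  obtain ⟨z, hz⟩ := hmin
  have hzG := isMinOn_moreauEnvelope hproper hlam hz
  rw [← moreauEnvelope_eq_toReal_iInf hlam hz] at hdom ⊢
  refine ⟨fun hα => ?_, fun hα => ?_⟩
  · have hextra := hu.isBigO_extrapolated ht₀ hconv hdiff hzG hα
    have hvalue := hu.isBigO ht₀ hconv hdiff hzG hα
    exact ⟨hextra, (hdom _).trans hextra, hvalue, (hdom u).trans hvalue⟩
  · have hextra := hu.isLittleO_extrapolated ht₀ hconv hdiff hzG hα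
    have hvalue := hu.isLittleO ht₀ hconv hdiff hzG hα
    obtain ⟨p, hp, hlim⟩ := hu.exists_tendsto_toWeakSpace ht₀ hconv hdiff hzG hα
    exact ⟨hextra, (hdom _).trans_isLittleO hextra, hvalue, (hdom u).trans_isLittleO hvalue,
      p, hlim, isMinOn_of_isMinOn_moreauEnvelope hproper ⟨z, hz⟩ hlam (hprox p) hp⟩
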